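/- Let $\mathcal X$ be a finite-dimensional real normed space and $\mathcal C\subset\mathcal X$ a closed convex cone with $\mathcal C\cap(-\mathcal C)=\{0\}$ and nonempty interior $\mathcal C^0$; write $x\le y$ if $y-x\in\mathcal C$ and $[x,y]=\{z: x\le z\le y\}$. For $x,y\in\mathcal C^0$ let $M(x/y)=\inf\{t\in\mathbb R: x\le ty\}$, $m(x/y)=\sup\{t\in\mathbb R: x\ge ty\}$, and let $d_H(x,y)=\log\bigl(M(x/y)/m(x/y)\bigr)$ be Hilbert's projective metric. For $x\in\mathcal C^0$ let $\mathcal P(x)$ be the set of linear functionals $\mu$ on $\mathcal X$ that are nonnegative on $\mathcal C$ and satisfy $\langle\mu,x\rangle=1$. Let $\operatorname{extr}$ denote the set of extreme points of a convex set. Let $\phi:\mathcal C^0\to\mathcal X$ be continuously differentiable with $\phi(\lambda x)=\lambda\phi(x)$ for all $\lambda>0$ and $x\in\mathcal C^0$, and let $t\mapsto M_t(x)$ be the maximal solution in $\mathcal C^0$ of $\dot x=\phi(x)$ with $M_0(x)=x$. Let $U\subset\mathcal C^0$ be a convex open set with $\lambda U=U$ for all $\lambda>0$. For $x\in U$ let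 $t_U(x)$ be the supremum of the times $t_0\ge 0$ such that $M_t(x)$ is defined and lies in $U$ for all $t\in[0,t_0)$. Let $\alpha(U)\in[-\infty,+\infty]$ be the infimum of all $a\in\mathbb R$ such that $$d_H(M_t(x_1),M_t(x_2))\le e^{at}\,d_H(x_1,x_2)$$ for all $x_1,x_2\in U$ and all $0\le t\le \min(t_U(x_1),t_U(x_2))$ at which both $M_t(x_1)$ and $M_t(x_2)$ are defined. For $x\in\mathcal C^0$ let $$c(x)=-\inf_{z\in[0,x]}\ \inf_{\substack{\nu,\pi\in\mathcal P(x)\\ \langle\pi,z\rangle+\langle\nu,x-z\rangle=0}}\ \langle\pi,D\phi(x)z\rangle+\langle\nu,D\phi(x)(x-z)\rangle .$$ Infima and suprema are taken in $[-\infty,+\infty]$, with $\inf\emptyset=+\infty$ and $\sup\emptyset=-\infty$. Then $$\alpha(U)=\sup_{x\in U}c(x),$$ and for every $x\in\mathcal C^0$, $$c(x)=-\inf_{z\in\operatorname{extr}[0,x]}\ \inf_{\substack{\nu,\pi\in\operatorname{extr}\mathcal P(x)\\ \langle\pi,z\rangle+\langle\nu,x-z\rangle=0}}\ \langle\pi,D\phi(x)z\rangle+\langle\nu,D\phi(x)(x-z)\rangle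 .$$ -/

import Mathlib

open scoped Pointwise

noncomputable section

namespace HilbertFlow

variable {E : Type*} [NormedAddCommGroup E] [NormedSpace ℝ E]

/-- The order interval `[x, y]` for the order `x ≤ y ↔ y - x ∈ C` induced by the cone `C`. -/
def orderInterval (C : ProperCone ℝ E) (x y : E) : Set E :=
  {z | z - x ∈ C ∧ y - z ∈ C}

/-- `M(x/y) = inf {t : x ≤ t y}`. -/
def bigM (C : ProperCone ℝ E) (x y : E) : ℝ :=
  sInf {t : ℝ | t • y - x ∈ C}

/-- `m(x/y) = sup {t : x ≥ t y}`. -/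
def smallM (C : ProperCone ℝ E) (x y : E) : ℝ :=
  sSup {t : ℝ | x - t • y ∈ C}

/-- Hilbert's projective metric `d_H(x, y) = log (M(x/y) / m(x/y))`, used for `x, y` in the
interior of the cone. -/
def hilbertDist (C : ProperCone ℝ E) (x y : E) : ℝ :=
  Real.log (bigM C x y / smallM C x y)

/-- The simplex `P(x)`: the elements `μ` of the dual cone with `⟨μ, x⟩ = 1`. -/
def simplex (C : ProperCone ℝ E) (x : E) : Set (StrongDual ℝ E) :=
  {μ | (∀ y ∈ C, 0 ≤ μ y) ∧ μ x = 1}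

/-- `FlowsTo C φ U t x y` says that the solution of `γ' = φ(γ)`, `γ(0) = x`, in the interior of
`C` exists on `[0, t]`, that it stays in `U` on `[0, t)`, and that `γ(t) = y`. In terms of the flow
`M` of the equation and of the time `t_U(x)` at which the orbit of `x` leaves `U`, this means that
`M_t(x)` is defined, `0 ≤ t ≤ t_U(x)` and `M_t(x) = y`. -/
def FlowsTo (C : ProperCone ℝ E) (φ : E → E) (U : Set E) (t : ℝ) (x y : E) : Prop :=
  0 ≤ t ∧ ∃ γ : ℝ → E, γ 0 = x ∧ γ t = y ∧
    (∀ s ∈ Set.Icc 0 t, γ s ∈ interior (C : Set E) ∧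
      HasDerivWithinAt γ (φ (γ s)) (Set.Icc 0 t) s) ∧
    ∀ s ∈ Set.Ico 0 t, γ s ∈ U

/-- `a` is a rate of exponential contraction on `U`, in Hilbert's metric, of the flow:
`d_H(M_t(x₁), M_t(x₂)) ≤ e^{a t} d_H(x₁, x₂)` for `x₁, x₂ ∈ U` as long as both orbits are
in `U`. -/
def IsContractionRate (C : ProperCone ℝ E) (φ : E → E) (U : Set E) (a : ℝ) : Prop :=
  ∀ x₁ ∈ U, ∀ x₂ ∈ U, ∀ (t : ℝ) (y₁ y₂ : E), FlowsTo C φ U t x₁ y₁ → FlowsTo C φ U t x₂ y₂ →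
    hilbertDist C y₁ y₂ ≤ Real.exp (a * t) * hilbertDist C x₁ x₂

/-- The optimal contraction rate `α(U)`, an extended real number (`inf ∅ = +∞`). -/
def contractionRate (C : ProperCone ℝ E) (φ : E → E) (U : Set E) : EReal :=
  ⨅ a ∈ {a : ℝ | IsContractionRate C φ U a}, (a : EReal)

/-- `- inf_{z ∈ Z} inf_{ν, π ∈ P, ⟨π, z⟩ + ⟨ν, x - z⟩ = 0} ⟨π, L z⟩ + ⟨ν, L (x - z)⟩`, an extended
real number (`inf ∅ = +∞`). -/
def rateOver (Z : Set E) (P : Set (StrongDual ℝ E)) (L : E →L[ℝ] E) (x : E) : EReal :=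
  -(⨅ z ∈ Z, ⨅ ν ∈ P, ⨅ π ∈ P, ⨅ _ : π z + ν (x - z) = 0,
    ((π (L z) + ν (L (x - z)) : ℝ) : EReal))

/-- The local rate `c(x)`, with `z` in `[0, x]` and `ν, π` in `P(x)`. -/
def localRate (C : ProperCone ℝ E) (φ : E → E) (x : E) : EReal :=
  rateOver (orderInterval C 0 x) (simplex C x) (fderiv ℝ φ x) x

/-- The same expression over the extreme points of `[0, x]` and of `P(x)`. -/
def localRateExtr (C : ProperCone ℝ E) (φ : E → E) (x : E) : EReal :=
  rateOver (Set.extremePoints ℝ (orderInterval C 0 x)) (Set.extremePoints ℝ (simplex C x))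
    (fderiv ℝ φ x) x

end HilbertFlow

end

/-!
Let `P` be the set of functionals in the dual cone normalized at some interior point `e`. It is
compact, the cone consists of the vectors on which all of `P` is nonnegative, and therefore
`d_H(x, y)` is the maximum over `ν, π ∈ P` of
`log (ν x / ν y) - log (π x / π y)` (`hilbertDist_eq`, `le_hilbertDist`).

*The contraction rate is at most `a` if all local rates on `U` are.* Along two orbits `y₁, y₂`, the
upper right derivative of `d_H(y₁, y₂)` is at most the derivative
`(ν (φ y₁) / ν y₁ - ν (φ y₂) / ν y₂) - (π (φ y₁) / π y₁ - π (φ y₂) / π y₂)`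
of the expression above for some maximizing pair (`frequently_slope_hilbertDist_lt`, an envelope
theorem for maxima over a compact set). This derivative is at most `a * d_H(y₁, y₂)`
(`logRatio_velocity_le`): when `y` runs over the segment from `y₂` to `y₁`, with velocity `w`, the
vectors `u = w - (π w / π y) y` and `v = (ν w / ν y) y - w` are in the cone, are annihilated by
`π` and `ν` respectively, and add up to a multiple of `y`. Up to scaling, `u` is thus admissible
as `z` in the definition of `c(y)`, and by Euler's identity `Dφ(y) y = φ(y)` the derivative of
`ν (φ y) / ν y - π (φ y) / π y` is, up to the same scaling, minus the corresponding value of the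
objective `⟨π, Dφ(y) z⟩ + ⟨ν, Dφ(y) (y - z)⟩`. Only segments inside `U` are used, so
the other points of a segment need not stay in `U` under the flow. Grönwall's inequality concludes.

*Every contraction rate `a` bounds the local rates on `U`.* For admissible `z, ν, π` at `x`, the
pair `(ν, π)` realizes `d_H(x + ε z, x) = log (1 + ε)` and gives a lower bound for the distance at
later times. Differentiating the contraction inequality at time `0`, and then in `ε` at `0`, gives
the inequality for `z, ν, π` (`localRate_le_of_isContractionRate`).

*Extreme points.* The constraint `π z + ν (x - z) = 0` says that a nonnegative expression, affine in
each of `z`, `ν`, `π`, vanishes. So with two of the variables fixed, it cuts out a face of a compact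
set, on which the objective is minimal at an extreme point (`exists_extremePoint_le`).
-/

namespace HilbertFlow

open Set Filter Topology

variable {E : Type*} [NormedAddCommGroup E] [NormedSpace ℝ E]

/-! ### Dual cone and compactness -/

theorem exists_add_smul_mem {S : Set E} {x : E} (hx : x ∈ interior S) (v : E) :
    ∃ s : ℝ, 0 < s ∧ x + s • v ∈ S := by
  have h : Tendsto (fun s : ℝ => x + s • v) (𝓝[>] 0) (𝓝 x) := by
    have : Continuous fun s : ℝ => x + s • v := by fun_prop
    simpa using (this.tendsto 0).mono_left nhdsWithin_le_nhds
  obtain ⟨s, hs, hs'⟩ :=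
    ((h.eventually (mem_interior_iff_mem_nhds.1 hx)).and self_mem_nhdsWithin).exists
  exact ⟨s, hs', hs⟩

theorem pos_of_nonneg_of_neg {C : ProperCone ℝ E} {f : StrongDual ℝ E} (hf : ∀ y ∈ C, 0 ≤ f y)
    {v x : E} (hv : f v < 0) (hx : x ∈ interior (C : Set E)) : 0 < f x := by
  obtain ⟨s, hs, hmem⟩ := exists_add_smul_mem hx v
  have h := hf _ hmem
  simp only [map_add, map_smul, smul_eq_mul] at h
  nlinarith [mul_neg_of_pos_of_neg hs hv]

theorem simplex_apply_pos {C : ProperCone ℝ E} {e x : E} {μ : StrongDual ℝ E}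
    (hμ : μ ∈ simplex C e) (hx : x ∈ interior (C : Set E)) : 0 < μ x :=
  pos_of_nonneg_of_neg hμ.1 (v := -e) (by simp [hμ.2]) hx

/-- The cone is recovered from the simplex of functionals normalized at an interior point. -/
theorem mem_of_forall_simplex_nonneg {C : ProperCone ℝ E} {e z : E}
    (he : e ∈ interior (C : Set E)) (h : ∀ μ ∈ simplex C e, 0 ≤ μ z) : z ∈ C := by
  by_contra hz
  obtain ⟨f, hf, hfz⟩ := C.hyperplane_separation_point hz
  have hfe := pos_of_nonneg_of_neg hf hfz he
  have := h ((f e)⁻¹ • f) ⟨fun y hy => by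
    simpa using mul_nonneg (inv_nonneg.2 hfe.le) (hf y hy), by simp [hfe.ne']⟩
  simp only [smul_apply, smul_eq_mul] at this
  exact absurd this (not_le.2 (mul_neg_of_pos_of_neg (inv_pos.2 hfe) hfz))

theorem simplex_nonempty {C : ProperCone ℝ E} (hpointed : ∀ x ∈ C, -x ∈ C → x = 0) {e : E}
    (he : e ∈ interior (C : Set E)) (he0 : e ≠ 0) : (simplex C e).Nonempty := by
  by_contra hne
  rw [not_nonempty_iff_eq_empty] at hne
  exact he0 (hpointed e (interior_subset he)
    (mem_of_forall_simplex_nonneg he (by simp [hne])))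

theorem isCompact_simplex [FiniteDimensional ℝ E] {C : ProperCone ℝ E} {e : E}
    (he : e ∈ interior (C : Set E)) : IsCompact (simplex C e) := by
  obtain ⟨r, hr, hball⟩ := Metric.mem_nhds_iff.1 (mem_interior_iff_mem_nhds.1 he)
  refine Metric.isCompact_of_isClosed_isBounded ?_ ?_
  · have : simplex C e = (⋂ y ∈ (C : Set E), {μ : StrongDual ℝ E | 0 ≤ μ y}) ∩
        {μ : StrongDual ℝ E | μ e = 1} := by
      ext μ; simp [simplex]
    rw [this]
    refine (isClosed_biInter fun y _ => isClosed_le continuous_const ?_).inter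
      (isClosed_eq ?_ continuous_const) <;> fun_prop
  · refine (Metric.isBounded_closedBall (x := (0 : StrongDual ℝ E)) (r := 2 / r)).subset ?_
    intro μ hμ
    rw [mem_closedBall_zero_iff]
    refine μ.opNorm_le_bound (by positivity) fun v => ?_
    rcases eq_or_ne v 0 with rfl | hv
    · simp
    have hv' : 0 < ‖v‖ := norm_pos_iff.2 hv
    have key : ∀ σ : ℝ, |σ| = 1 → 0 ≤ 1 + σ * (r / 2 / ‖v‖ * μ v) := by
      intro σ hσ
      have hmem : e + (σ * (r / 2 / ‖v‖)) • v ∈ Metric.ball e r := by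
        rw [Metric.mem_ball, dist_eq_norm, add_sub_cancel_left, norm_smul, Real.norm_eq_abs,
          abs_mul, hσ, abs_of_pos (by positivity)]
        field_simp
        linarith
      have := hμ.1 _ (hball hmem)
      rw [map_add, hμ.2, map_smul, smul_eq_mul, mul_assoc] at this
      exact this
    have h1 := key 1 (by simp)
    have h2 := key (-1) (by simp)
    have h3 : |r / 2 / ‖v‖ * μ v| ≤ 1 := abs_le.2 ⟨by linarith, by linarith⟩
    rw [abs_mul, abs_of_pos (by positivity)] at h3
    rw [Real.norm_eq_abs]
    calc |μ v| = 2 / r * ‖v‖ * (r / 2 / ‖v‖ * |μ v|) := by field_simp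
      _ ≤ 2 / r * ‖v‖ * 1 := by gcongr
      _ = _ := mul_one _

/-- In finite dimension a closed pointed cone is normal, so order intervals are bounded: the
distance from `-k` to the cone is bounded below on the unit vectors `k` of the cone. -/
theorem isCompact_orderInterval [FiniteDimensional ℝ E] {C : ProperCone ℝ E}
    (hpointed : ∀ x ∈ C, -x ∈ C → x = 0) (x : E) : IsCompact (orderInterval C 0 x) := by
  have hK : IsCompact ((C : Set E) ∩ Metric.sphere 0 1) :=
    (isCompact_sphere (0 : E) 1).inter_left C.isClosed
  have hcont : Continuous fun k : E => Metric.infDist (-k) (C : Set E) :=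
    (Metric.continuous_infDist_pt _).comp continuous_neg
  obtain ⟨δ, hδ, hδK⟩ : ∃ δ > 0, ∀ k ∈ (C : Set E) ∩ Metric.sphere 0 1,
      δ ≤ Metric.infDist (-k) (C : Set E) := by
    refine hK.exists_forall_le' (a := 0) hcont.continuousOn fun k hk => ?_
    refine (C.isClosed.notMem_iff_infDist_pos C.nonempty).1 fun hneg => ?_
    have := hpointed k hk.1 hneg
    simp [this] at hk
  refine Metric.isCompact_of_isClosed_isBounded ?_ ?_
  · exact (C.isClosed.preimage (f := fun z : E => z - 0) (by fun_prop)).inter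
      (C.isClosed.preimage (f := fun z : E => x - z) (by fun_prop))
  · refine (Metric.isBounded_closedBall (x := (0 : E)) (r := ‖x‖ / δ)).subset fun z hz => ?_
    rw [mem_closedBall_zero_iff]
    rcases eq_or_ne z 0 with rfl | hz0
    · simp; positivity
    have hz' : 0 < ‖z‖ := norm_pos_iff.2 hz0
    have hzC : z ∈ C := by simpa using hz.1
    have h1 := hδK (‖z‖⁻¹ • z) ⟨C.smul_mem hzC (by positivity), by
      simp [norm_smul, hz'.ne']⟩
    have h2 : Metric.infDist (-(‖z‖⁻¹ • z)) (C : Set E) ≤ ‖x‖ / ‖z‖ := by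
      refine (Metric.infDist_le_dist_of_mem
        (C.smul_mem hz.2 (r := ‖z‖⁻¹) (by positivity))).trans_eq ?_
      rw [dist_eq_norm, smul_sub, ← norm_neg]
      simp [norm_smul, div_eq_inv_mul]
    rw [le_div_iff₀ hδ]
    have := (le_div_iff₀ hz').1 (h1.trans h2)
    linarith

/-! ### Reduction to extreme points -/

/-- On the face of a compact set where a linear functional `f` attains its minimum, a second
functional `g` attains its own minimum at an extreme point of the whole set. -/
theorem exists_extremePoint_le {V : Type*} [NormedAddCommGroup V] [NormedSpace ℝ V] {K : Set V}
    (hK : IsCompact K) (f g : StrongDual ℝ V) {k : V} (hk : k ∈ K) (hf : ∀ y ∈ K, f k ≤ f y) :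
    ∃ k' ∈ K.extremePoints ℝ, f k' = f k ∧ g k' ≤ g k := by
  have hA : IsExposed ℝ K ((-f).toExposed K) := ContinuousLinearMap.toExposed.isExposed
  have hAc := hA.isCompact hK
  have hkA : k ∈ (-f).toExposed K := ⟨hk, fun y hy => by simpa using hf y hy⟩
  have hB : IsExposed ℝ ((-f).toExposed K) ((-g).toExposed ((-f).toExposed K)) :=
    ContinuousLinearMap.toExposed.isExposed
  obtain ⟨b, hb, hbmin⟩ := hAc.exists_isMinOn ⟨k, hkA⟩ g.continuous.continuousOn
  obtain ⟨k', hk'⟩ := (hB.isCompact hAc).extremePoints_nonempty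
    ⟨b, hb, fun y hy => by simpa using hbmin hy⟩
  refine ⟨k', (hA.isExtreme.trans hB.isExtreme).extremePoints_subset_extremePoints hk', ?_, ?_⟩
  · exact le_antisymm (by simpa using hk'.1.1.2 k hk) (hf k' hk'.1.1.1)
  · simpa using hk'.1.2 k hkA

theorem localRate_eq_localRateExtr [FiniteDimensional ℝ E] {C : ProperCone ℝ E}
    (hpointed : ∀ x ∈ C, -x ∈ C → x = 0) (φ : E → E) {x : E} (hx : x ∈ interior (C : Set E)) :
    localRate C φ x = localRateExtr C φ x := by
  have hP := isCompact_simplex hx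
  have hZ := isCompact_orderInterval hpointed x
  unfold localRate localRateExtr rateOver
  congr 1
  set L := fderiv ℝ φ x
  refine le_antisymm ?_ ?_
  · refine le_iInf₂ fun z hz => le_iInf₂ fun ν hν => le_iInf₂ fun π hπ => le_iInf fun h => ?_
    exact iInf₂_le_of_le z hz.1 (iInf₂_le_of_le ν hν.1 (iInf₂_le_of_le π hπ.1
      (iInf_le_of_le h le_rfl)))
  · refine le_iInf₂ fun z hz => le_iInf₂ fun ν hν => le_iInf₂ fun π hπ => le_iInf fun h => ?_
    have nonneg : ∀ z ∈ orderInterval C 0 x, ∀ ν ∈ simplex C x, ∀ π ∈ simplex C x,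
        0 ≤ π z + ν (x - z) := fun z hz ν hν π hπ =>
      add_nonneg (hπ.1 _ (by simpa using hz.1)) (hν.1 _ hz.2)
    -- The constraint is a minimality condition in each of the three variables separately, so
    -- they are moved to extreme points one after the other.
    obtain ⟨z', hz', h1, g1⟩ := exists_extremePoint_le hZ (π - ν) ((π - ν).comp L) hz fun y hy => by
      have := nonneg y hy ν hν π hπ
      simp only [map_sub, sub_apply] at h this ⊢
      linarith
    simp only [sub_apply, ContinuousLinearMap.comp_apply] at h1 g1
    have h' : π z' + ν (x - z') = 0 := by rw [map_sub] at h ⊢; linarith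
    have hπ0 := hπ.1 z' (by simpa using hz'.1.1)
    have hν0 := hν.1 _ hz'.1.2
    obtain ⟨ν', hν', h2, g2⟩ := exists_extremePoint_le hP
      (ContinuousLinearMap.apply ℝ ℝ (x - z')) (ContinuousLinearMap.apply ℝ ℝ (L (x - z'))) hν
      fun y hy => by
        have := hy.1 _ hz'.1.2
        simp only [ContinuousLinearMap.apply_apply]
        linarith
    obtain ⟨π', hπ', h3, g3⟩ := exists_extremePoint_le hP
      (ContinuousLinearMap.apply ℝ ℝ z') (ContinuousLinearMap.apply ℝ ℝ (L z')) hπ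
      fun y hy => by
        have := hy.1 z' (by simpa using hz'.1.1)
        simp only [ContinuousLinearMap.apply_apply]
        linarith
    simp only [ContinuousLinearMap.apply_apply] at h2 g2 h3 g3
    refine iInf₂_le_of_le z' hz' (iInf₂_le_of_le ν' hν' (iInf₂_le_of_le π' hπ'
      (iInf_le_of_le (by rw [h2, h3]; exact h') ?_)))
    rw [EReal.coe_le_coe_iff]
    simp only [map_sub] at g2 ⊢
    linarith

/-! ### Hilbert's metric as a maximum over pairs of functionals -/

/-- `ν` maximizes the quotient `μ x / μ y` among the functionals `μ ∈ P` (the condition is written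
without division, so that it is closed). -/
def IsMaxRatio (P : Set (StrongDual ℝ E)) (x y : E) (ν : StrongDual ℝ E) : Prop :=
  ν ∈ P ∧ ∀ μ ∈ P, μ x * ν y ≤ ν x * μ y

theorem exists_isMaxRatio [FiniteDimensional ℝ E] {C : ProperCone ℝ E} {e x y : E}
    (he : e ∈ interior (C : Set E)) (hy : y ∈ interior (C : Set E))
    (hne : (simplex C e).Nonempty) : ∃ ν, IsMaxRatio (simplex C e) x y ν := by
  have hcont : ContinuousOn (fun μ : StrongDual ℝ E => μ x / μ y) (simplex C e) :=
    ContinuousOn.div (by fun_prop) (by fun_prop) fun μ hμ => (simplex_apply_pos hμ hy).ne'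
  obtain ⟨ν, hν, hmax⟩ := (isCompact_simplex he).exists_isMaxOn hne hcont
  refine ⟨ν, hν, fun μ hμ => ?_⟩
  exact (div_le_div_iff₀ (simplex_apply_pos hμ hy) (simplex_apply_pos hν hy)).1 (hmax hμ)

theorem hilbertDist_eq {C : ProperCone ℝ E} {e x y : E} {ν π : StrongDual ℝ E}
    (he : e ∈ interior (C : Set E)) (hx : x ∈ interior (C : Set E))
    (hy : y ∈ interior (C : Set E)) (hν : IsMaxRatio (simplex C e) x y ν)
    (hπ : IsMaxRatio (simplex C e) y x π) :
    hilbertDist C x y =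
      (Real.log (ν x) - Real.log (ν y)) - (Real.log (π x) - Real.log (π y)) := by
  have hνx := simplex_apply_pos hν.1 hx
  have hνy := simplex_apply_pos hν.1 hy
  have hπx := simplex_apply_pos hπ.1 hx
  have hπy := simplex_apply_pos hπ.1 hy
  have hM : bigM C x y = ν x / ν y := by
    have : {t : ℝ | t • y - x ∈ C} = Ici (ν x / ν y) := by
      ext t
      refine ⟨fun ht => ?_, fun ht => mem_of_forall_simplex_nonneg he fun μ hμ => ?_⟩
      · have := hν.1.1 _ ht
        simp only [map_sub, map_smul, smul_eq_mul] at this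
        exact (div_le_iff₀ hνy).2 (by linarith)
      · have hμy := simplex_apply_pos hμ hy
        have h1 := (div_le_div_iff₀ hμy hνy).2 (hν.2 μ hμ)
        have := (div_le_iff₀ hμy).1 (h1.trans ht)
        simp only [map_sub, map_smul, smul_eq_mul]
        linarith
    rw [bigM, this, csInf_Ici]
  have hm : smallM C x y = π x / π y := by
    have : {t : ℝ | x - t • y ∈ C} = Iic (π x / π y) := by
      ext t
      refine ⟨fun ht => ?_, fun ht => mem_of_forall_simplex_nonneg he fun μ hμ => ?_⟩
      · have := hπ.1.1 _ ht
        simp only [map_sub, map_smul, smul_eq_mul] at this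
        exact (le_div_iff₀ hπy).2 (by linarith)
      · have hμy := simplex_apply_pos hμ hy
        have h1 : π x / π y ≤ μ x / μ y :=
          (div_le_div_iff₀ hπy hμy).2 (by linarith [hπ.2 μ hμ])
        have := (le_div_iff₀ hμy).1 (ht.trans h1)
        simp only [map_sub, map_smul, smul_eq_mul]
        linarith
    rw [smallM, this, csSup_Iic]
  rw [hilbertDist, hM, hm, Real.log_div (by positivity) (by positivity),
    Real.log_div (by positivity) (by positivity), Real.log_div (by positivity) (by positivity)]

theorem le_hilbertDist [FiniteDimensional ℝ E] {C : ProperCone ℝ E} {e x y : E}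
    {ν π : StrongDual ℝ E}
    (he : e ∈ interior (C : Set E)) (hx : x ∈ interior (C : Set E))
    (hy : y ∈ interior (C : Set E)) (hν : ν ∈ simplex C e) (hπ : π ∈ simplex C e) :
    (Real.log (ν x) - Real.log (ν y)) - (Real.log (π x) - Real.log (π y)) ≤ hilbertDist C x y := by
  obtain ⟨ν', hν'⟩ := exists_isMaxRatio (x := x) he hy ⟨ν, hν⟩
  obtain ⟨π', hπ'⟩ := exists_isMaxRatio (x := y) he hx ⟨ν, hν⟩
  rw [hilbertDist_eq he hx hy hν' hπ']
  have key : ∀ {u v : E} {μ ρ : StrongDual ℝ E}, u ∈ interior (C : Set E) →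
      v ∈ interior (C : Set E) → μ ∈ simplex C e → IsMaxRatio (simplex C e) u v ρ →
      Real.log (μ u) - Real.log (μ v) ≤ Real.log (ρ u) - Real.log (ρ v) := by
    intro u v μ ρ hu hv hμ hρ
    have h1 := simplex_apply_pos hμ hu
    have h2 := simplex_apply_pos hμ hv
    have h3 := simplex_apply_pos hρ.1 hu
    have h4 := simplex_apply_pos hρ.1 hv
    have := Real.log_le_log (by positivity) (hρ.2 μ hμ)
    rw [Real.log_mul h1.ne' h4.ne', Real.log_mul h3.ne' h2.ne'] at this
    linarith
  linarith [key hx hy hν hν', key hy hx hπ hπ']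

/-! ### The infinitesimal inequality -/

theorem localRate_le_iff {C : ProperCone ℝ E} {φ : E → E} {x : E} {a : ℝ} :
    localRate C φ x ≤ a ↔ ∀ z ∈ orderInterval C 0 x, ∀ ν ∈ simplex C x, ∀ π ∈ simplex C x,
      π z + ν (x - z) = 0 → -a ≤ π (fderiv ℝ φ x z) + ν (fderiv ℝ φ x (x - z)) := by
  rw [localRate, rateOver, EReal.neg_le]
  simp only [le_iInf_iff, ← EReal.coe_neg, EReal.coe_le_coe_iff]

/-- The inequality that defines the local rate, without the normalizations
`π x = ν x = 1` and `u + v = x`. -/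
theorem neg_mul_le_of_localRate_le {C : ProperCone ℝ E} (hpointed : ∀ x ∈ C, -x ∈ C → x = 0)
    {φ : E → E} {x u v : E} {a ω : ℝ} {ν π : StrongDual ℝ E} (ha : localRate C φ x ≤ a)
    (hν : ∀ y ∈ C, 0 ≤ ν y) (hνx : 0 < ν x) (hπ : ∀ y ∈ C, 0 ≤ π y) (hπx : 0 < π x)
    (hu : u ∈ C) (hv : v ∈ C) (huv : u + v = ω • x) (hπu : π u = 0) (hνv : ν v = 0) :
    -(a * ω) ≤ π (fderiv ℝ φ x u) / π x + ν (fderiv ℝ φ x v) / ν x := by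
  have hω : ω * ν x = ν u := by
    have := congrArg ν huv
    simp only [map_add, map_smul, smul_eq_mul, hνv, add_zero] at this
    exact this.symm
  have hω0 : 0 ≤ ω := nonneg_of_mul_nonneg_left (hω ▸ hν u hu) hνx
  rcases hω0.eq_or_lt with rfl | hωpos
  · -- Here `v = -u`, so both vanish because the cone is pointed.
    rw [zero_smul] at huv
    obtain rfl : v = -u := (neg_eq_of_add_eq_zero_right huv).symm
    obtain rfl := hpointed u hu hv
    simp
  have hxu : x - ω⁻¹ • u = ω⁻¹ • v := by
    rw [← eq_sub_iff_add_eq'] at huv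
    rw [huv, smul_sub, inv_smul_smul₀ hωpos.ne']
  have norm_mem : ∀ {μ : StrongDual ℝ E}, (∀ y ∈ C, 0 ≤ μ y) → 0 < μ x →
      (μ x)⁻¹ • μ ∈ simplex C x := fun hμ hμx =>
    ⟨fun y hy => by simpa using mul_nonneg (inv_nonneg.2 hμx.le) (hμ y hy), by simp [hμx.ne']⟩
  have h := localRate_le_iff.1 ha (ω⁻¹ • u)
    ⟨by simpa using C.smul_mem hu (inv_nonneg.2 hω0), hxu ▸ C.smul_mem hv (inv_nonneg.2 hω0)⟩
    _ (norm_mem hν hνx) _ (norm_mem hπ hπx) (by rw [hxu]; simp [hπu, hνv])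
  rw [hxu] at h
  simp only [smul_apply, map_smul, smul_eq_mul] at h
  have h2 := mul_le_mul_of_nonneg_right h hω0
  calc -(a * ω) = -a * ω := by ring
    _ ≤ _ := h2
    _ = _ := by field_simp

theorem hasFDerivAt_of_contDiffOn_interior {S : Set E} {φ : E → E}
    (hφ : ContDiffOn ℝ 1 φ (interior S)) {x : E} (hx : x ∈ interior S) :
    HasFDerivAt φ (fderiv ℝ φ x) x :=
  ((hφ.contDiffAt (isOpen_interior.mem_nhds hx)).differentiableAt one_ne_zero).hasFDerivAt

/-- Euler's identity for a map that is homogeneous of degree one. -/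
theorem fderiv_apply_self {S : Set E} {φ : E → E} (hφ : ContDiffOn ℝ 1 φ (interior S))
    (hhom : ∀ r : ℝ, 0 < r → ∀ x ∈ interior S, φ (r • x) = r • φ x)
    {x : E} (hx : x ∈ interior S) : fderiv ℝ φ x x = φ x := by
  have h1 : HasDerivAt (fun r : ℝ => r • x) x 1 := by
    simpa using (hasDerivAt_id (1 : ℝ)).smul_const x
  have h2 : HasDerivAt (fun r : ℝ => φ (r • x)) (fderiv ℝ φ x x) 1 :=
    HasFDerivAt.comp_hasDerivAt (f := fun r : ℝ => r • x) 1
      (by simpa using hasFDerivAt_of_contDiffOn_interior hφ hx) h1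
  have h3 : HasDerivAt (fun r : ℝ => r • φ x) (φ x) 1 := by
    simpa using (hasDerivAt_id (1 : ℝ)).smul_const (φ x)
  refine h2.unique (h3.congr_of_eventuallyEq ?_)
  filter_upwards [lt_mem_nhds (zero_lt_one' ℝ)] with r hr using hhom r hr x hx

/-- If `y₁, y₂` move with velocities `φ y₁, φ y₂`, the left side is the derivative of
`log (ν y₁ / ν y₂) - log (π y₁ / π y₂)`, and the right side is `a * d_H(y₁, y₂)`. The bound on the
local rate is integrated along the segment from `y₂` to `y₁`: there the derivative of
`ν (φ y) / ν y - π (φ y) / π y - a (log (ν y) - log (π y))` is nonpositive. -/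
theorem logRatio_velocity_le {C : ProperCone ℝ E} (hpointed : ∀ x ∈ C, -x ∈ C → x = 0)
    {φ : E → E} (hφ : ContDiffOn ℝ 1 φ (interior (C : Set E)))
    (hhom : ∀ r : ℝ, 0 < r → ∀ x ∈ interior (C : Set E), φ (r • x) = r • φ x)
    {U : Set E} (hUC : U ⊆ interior (C : Set E)) (hUconv : Convex ℝ U) {a : ℝ}
    (ha : ∀ x ∈ U, localRate C φ x ≤ a) {e y₁ y₂ : E} (he : e ∈ interior (C : Set E))
    (hy₁ : y₁ ∈ U) (hy₂ : y₂ ∈ U) {ν π : StrongDual ℝ E}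
    (hν : IsMaxRatio (simplex C e) y₁ y₂ ν) (hπ : IsMaxRatio (simplex C e) y₂ y₁ π) :
    (ν (φ y₁) / ν y₁ - ν (φ y₂) / ν y₂) - (π (φ y₁) / π y₁ - π (φ y₂) / π y₂) ≤
      a * ((Real.log (ν y₁) - Real.log (ν y₂)) - (Real.log (π y₁) - Real.log (π y₂))) := by
  set w := y₁ - y₂ with hw
  let y : ℝ → E := fun r => y₂ + r • w
  have hyU : ∀ r ∈ Icc (0 : ℝ) 1, y r ∈ U := fun r hr => hUconv.add_smul_sub_mem hy₂ hy₁ hr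
  let K : ℝ → ℝ := fun r => ν (φ (y r)) / ν (y r) - π (φ (y r)) / π (y r) -
    a * (Real.log (ν (y r)) - Real.log (π (y r)))
  have hK : ∀ r ∈ Icc (0 : ℝ) 1, ∃ d ≤ 0, HasDerivAt K d r := by
    intro r hr
    have hyr := hUC (hyU r hr)
    have hνy := simplex_apply_pos hν.1 hyr
    have hπy := simplex_apply_pos hπ.1 hyr
    have dy : HasDerivAt y w r := by
      simpa [y] using ((hasDerivAt_id r).smul_const w).const_add y₂
    have dφ : HasDerivAt (fun r => φ (y r)) (fderiv ℝ φ (y r) w) r :=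
      (hasFDerivAt_of_contDiffOn_interior hφ hyr).comp_hasDerivAt r dy
    have dν := ν.hasFDerivAt.comp_hasDerivAt r dy
    have dπ := π.hasFDerivAt.comp_hasDerivAt r dy
    have dνφ := ν.hasFDerivAt.comp_hasDerivAt r dφ
    have dπφ := π.hasFDerivAt.comp_hasDerivAt r dφ
    refine ⟨_, ?_, ((dνφ.div dν hνy.ne').sub (dπφ.div dπ hπy.ne')).sub
      (((dν.log hνy.ne').sub (dπ.log hπy.ne')).const_mul a)⟩
    simp only [Function.comp_apply]
    rw [← fderiv_apply_self hφ hhom hyr]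
    set L := fderiv ℝ φ (y r)
    set p := ν w / ν (y r) with hp
    set q := π w / π (y r) with hq
    -- `w - q y` and `p y - w` are positive multiples of `y₁ - m y₂` and `M y₂ - y₁`, where `m` and
    -- `M` are the extreme ratios `m(y₁/y₂)` and `M(y₁/y₂)`; hence they lie in the cone.
    have hu : w - q • y r ∈ C := mem_of_forall_simplex_nonneg he fun μ hμ => by
      have h := hπ.2 μ hμ
      have : 0 ≤ μ w * π (y r) - π w * μ (y r) := by
        simp only [y, w, map_add, map_smul, map_sub, smul_eq_mul]
        linarith
      simp only [map_sub, map_smul, smul_eq_mul, hq]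
      calc 0 ≤ (μ w * π (y r) - π w * μ (y r)) / π (y r) := by positivity
        _ = _ := by field_simp
    have hv : p • y r - w ∈ C := mem_of_forall_simplex_nonneg he fun μ hμ => by
      have h := hν.2 μ hμ
      have : 0 ≤ ν w * μ (y r) - μ w * ν (y r) := by
        simp only [y, w, map_add, map_smul, map_sub, smul_eq_mul]
        linarith
      simp only [map_sub, map_smul, smul_eq_mul, hp]
      calc 0 ≤ (ν w * μ (y r) - μ w * ν (y r)) / ν (y r) := by positivity
        _ = _ := by field_simp
    have h := neg_mul_le_of_localRate_le hpointed (ω := p - q) (ha _ (hyU r hr)) hν.1.1 hνy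
      hπ.1.1 hπy hu hv (by rw [sub_smul]; abel)
      (by simp only [map_sub, map_smul, smul_eq_mul, hq]; field_simp; simp)
      (by simp only [map_sub, map_smul, smul_eq_mul, hp]; field_simp; simp)
    simp only [map_sub, map_smul, smul_eq_mul] at h
    have e1 : ν (L w) * ν (y r) - ν (L (y r)) * ν w = (ν (L w) - p * ν (L (y r))) * ν (y r) := by
      rw [hp]; field_simp
    have e2 : π (L w) * π (y r) - π (L (y r)) * π w = (π (L w) - q * π (L (y r))) * π (y r) := by
      rw [hq]; field_simp
    rw [e1, e2, sq, sq, mul_div_mul_right _ _ hνy.ne', mul_div_mul_right _ _ hπy.ne']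
    have e3 : (p * ν (L (y r)) - ν (L w)) / ν (y r) = -((ν (L w) - p * ν (L (y r))) / ν (y r)) := by
      ring
    rw [e3] at h
    linarith
  have hanti : AntitoneOn K (Icc 0 1) := by
    refine antitoneOn_of_deriv_nonpos (convex_Icc 0 1) ?_ ?_ ?_
    · intro r hr
      obtain ⟨d, -, hd⟩ := hK r hr
      exact hd.continuousAt.continuousWithinAt
    · intro r hr
      obtain ⟨d, -, hd⟩ := hK r (interior_subset hr)
      exact hd.differentiableAt.differentiableWithinAt
    · intro r hr
      obtain ⟨d, h0, hd⟩ := hK r (interior_subset hr)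
      rwa [hd.deriv]
  have h01 := hanti (left_mem_Icc.2 zero_le_one) (right_mem_Icc.2 zero_le_one) zero_le_one
  have y0 : y 0 = y₂ := by simp [y]
  have y1 : y 1 = y₁ := by simp [y, w]
  simp only [K, y0, y1] at h01
  linarith

/-! ### Variation of Hilbert's metric along two curves -/

theorem tendsto_dual_apply {ι : Type*} {l : Filter ι} {N : ι → StrongDual ℝ E} {X : ι → E}
    {ν : StrongDual ℝ E} {x : E} (hN : Tendsto N l (𝓝 ν)) (hX : Tendsto X l (𝓝 x)) :
    Tendsto (fun i => N i (X i)) l (𝓝 (ν x)) :=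
  (isBoundedBilinearMap_apply (𝕜 := ℝ) (E := E) (F := ℝ)).continuous.continuousAt.tendsto.comp
    (hN.prodMk_nhds hX)

/-- Compactness of the simplex: along an ultrafilter, maximizing functionals for converging pairs
of points converge to a maximizing functional for the limit. -/
theorem exists_tendsto_isMaxRatio [FiniteDimensional ℝ E] {C : ProperCone ℝ E} {e : E}
    (he : e ∈ interior (C : Set E)) (hne : (simplex C e).Nonempty) {ι : Type*} {g : Ultrafilter ι}
    {X Y : ι → E} {x y : E} (hX : Tendsto X g (𝓝 x)) (hY : Tendsto Y g (𝓝 y))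
    (hy : y ∈ interior (C : Set E)) :
    ∃ (N : ι → StrongDual ℝ E) (ν : StrongDual ℝ E),
      (∀ᶠ i in g, IsMaxRatio (simplex C e) (X i) (Y i) (N i)) ∧ Tendsto N g (𝓝 ν) ∧
      IsMaxRatio (simplex C e) x y ν := by
  have : ∀ i, ∃ ν, Y i ∈ interior (C : Set E) → IsMaxRatio (simplex C e) (X i) (Y i) ν := by
    intro i
    by_cases h : Y i ∈ interior (C : Set E)
    · obtain ⟨ν, hν⟩ := exists_isMaxRatio (x := X i) he h hne
      exact ⟨ν, fun _ => hν⟩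
    · exact ⟨0, fun h' => absurd h' h⟩
  choose N hN using this
  have hev : ∀ᶠ i in g, IsMaxRatio (simplex C e) (X i) (Y i) (N i) :=
    (hY.eventually (isOpen_interior.mem_nhds hy)).mono hN
  obtain ⟨ν, hν, hlim⟩ := (isCompact_simplex he).ultrafilter_le_nhds (g.map N)
    (le_principal_iff.2 (hev.mono fun i hi => hi.1))
  replace hlim : Tendsto N g (𝓝 ν) := hlim
  refine ⟨N, ν, hev, hlim, hν, fun μ hμ => ?_⟩
  exact le_of_tendsto_of_tendsto (((μ.continuous.tendsto x).comp hX).mul (tendsto_dual_apply hlim hY))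
    ((tendsto_dual_apply hlim hX).mul ((μ.continuous.tendsto y).comp hY)) (hev.mono fun i hi => hi.2 μ hμ)

theorem tendsto_hilbertDist [FiniteDimensional ℝ E] {C : ProperCone ℝ E} {e : E}
    (he : e ∈ interior (C : Set E)) (hne : (simplex C e).Nonempty) {ι : Type*} {l : Filter ι}
    {X Y : ι → E} {x y : E} (hX : Tendsto X l (𝓝 x)) (hY : Tendsto Y l (𝓝 y))
    (hx : x ∈ interior (C : Set E)) (hy : y ∈ interior (C : Set E)) :
    Tendsto (fun i => hilbertDist C (X i) (Y i)) l (𝓝 (hilbertDist C x y)) := by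
  rw [tendsto_iff_ultrafilter]
  intro g hg
  replace hX := hX.mono_left hg
  replace hY := hY.mono_left hg
  obtain ⟨N, ν, hN, hNlim, hν⟩ := exists_tendsto_isMaxRatio he hne hX hY hy
  obtain ⟨Q, π, hQ, hQlim, hπ⟩ := exists_tendsto_isMaxRatio he hne hY hX hx
  rw [hilbertDist_eq he hx hy hν hπ]
  have hlog : ∀ {N : ι → StrongDual ℝ E} {ν : StrongDual ℝ E} {X : ι → E} {x : E},
      Tendsto N g (𝓝 ν) → Tendsto X g (𝓝 x) → x ∈ interior (C : Set E) → ν ∈ simplex C e →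
      Tendsto (fun i => Real.log (N i (X i))) g (𝓝 (Real.log (ν x))) := fun hN hX hx hν =>
    (tendsto_dual_apply hN hX).log (simplex_apply_pos hν hx).ne'
  refine (((hlog hNlim hX hx hν.1).sub (hlog hNlim hY hy hν.1)).sub
    ((hlog hQlim hX hx hπ.1).sub (hlog hQlim hY hy hπ.1))).congr' ?_
  filter_upwards [hN, hQ, hX.eventually (isOpen_interior.mem_nhds hx),
    hY.eventually (isOpen_interior.mem_nhds hy)] with i h1 h2 h3 h4
  exact (hilbertDist_eq he h3 h4 h1 h2).symm

theorem log_sub_log_le {A B : ℝ} (hA : 0 < A) (hB : 0 < B) :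
    Real.log A - Real.log B ≤ (A - B) / B := by
  rw [← Real.log_div hA.ne' hB.ne', sub_div, div_self hB.ne']
  exact Real.log_le_sub_one_of_pos (by positivity)

/-- A bound on the upper right Dini derivative of Hilbert's distance between two curves: it is at
most the derivative of the log-ratio for suitable maximizing functionals. The functionals that are
optimal at a later time `z` give an upper bound for the difference quotient, and they accumulate at
optimal functionals as `z → t`. -/
theorem frequently_slope_hilbertDist_lt [FiniteDimensional ℝ E] {C : ProperCone ℝ E} {e : E}
    (he : e ∈ interior (C : Set E)) (hne : (simplex C e).Nonempty) {γ₁ γ₂ : ℝ → E} {t r : ℝ}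
    {v₁ v₂ : E} (hγ₁ : HasDerivWithinAt γ₁ v₁ (Ioi t) t) (hγ₂ : HasDerivWithinAt γ₂ v₂ (Ioi t) t)
    (h₁ : γ₁ t ∈ interior (C : Set E)) (h₂ : γ₂ t ∈ interior (C : Set E))
    (hr : ∀ ν π, IsMaxRatio (simplex C e) (γ₁ t) (γ₂ t) ν →
      IsMaxRatio (simplex C e) (γ₂ t) (γ₁ t) π →
      (ν v₁ / ν (γ₁ t) - ν v₂ / ν (γ₂ t)) - (π v₁ / π (γ₁ t) - π v₂ / π (γ₂ t)) < r) :
    ∃ᶠ z in 𝓝[>] t,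
      (z - t)⁻¹ * (hilbertDist C (γ₁ z) (γ₂ z) - hilbertDist C (γ₁ t) (γ₂ t)) < r := by
  intro hcon
  let g : Ultrafilter ℝ := Ultrafilter.of (𝓝[>] t)
  have hg : (g : Filter ℝ) ≤ 𝓝[>] t := Ultrafilter.of_le _
  have c₁ : Tendsto γ₁ g (𝓝 (γ₁ t)) := hγ₁.continuousWithinAt.mono_left hg
  have c₂ : Tendsto γ₂ g (𝓝 (γ₂ t)) := hγ₂.continuousWithinAt.mono_left hg
  have s₁ : Tendsto (slope γ₁ t) g (𝓝 v₁) :=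
    ((hasDerivWithinAt_iff_tendsto_slope' (lt_irrefl t)).1 hγ₁).mono_left hg
  have s₂ : Tendsto (slope γ₂ t) g (𝓝 v₂) :=
    ((hasDerivWithinAt_iff_tendsto_slope' (lt_irrefl t)).1 hγ₂).mono_left hg
  obtain ⟨N, ν, hN, hNlim, hν⟩ := exists_tendsto_isMaxRatio he hne c₁ c₂ h₂
  obtain ⟨Q, π, hQ, hQlim, hπ⟩ := exists_tendsto_isMaxRatio he hne c₂ c₁ h₁
  have cst : ∀ v : E, Tendsto (fun _ : ℝ => v) g (𝓝 v) := fun v => tendsto_const_nhds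
  have lim := (((tendsto_dual_apply hNlim s₁).div (tendsto_dual_apply hNlim (cst (γ₁ t)))
      (simplex_apply_pos hν.1 h₁).ne').sub ((tendsto_dual_apply hNlim s₂).div (tendsto_dual_apply hNlim c₂)
      (simplex_apply_pos hν.1 h₂).ne')).sub
    (((tendsto_dual_apply hQlim s₁).div (tendsto_dual_apply hQlim c₁) (simplex_apply_pos hπ.1 h₁).ne').sub
      ((tendsto_dual_apply hQlim s₂).div (tendsto_dual_apply hQlim (cst (γ₂ t))) (simplex_apply_pos hπ.1 h₂).ne'))
  refine absurd (ge_of_tendsto lim ?_) (not_le.2 (hr ν π hν hπ))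
  filter_upwards [hN, hQ, hg hcon, hg self_mem_nhdsWithin,
    c₁.eventually (isOpen_interior.mem_nhds h₁),
    c₂.eventually (isOpen_interior.mem_nhds h₂)] with z hNz hQz hz htz i₁ i₂
  refine (not_lt.1 hz).trans ?_
  have hzt : 0 < z - t := sub_pos.2 htz
  have low := le_hilbertDist he h₁ h₂ hNz.1 hQz.1
  rw [hilbertDist_eq he i₁ i₂ hNz hQz]
  have b₁ := log_sub_log_le (simplex_apply_pos hNz.1 i₁) (simplex_apply_pos hNz.1 h₁)
  have b₂ := log_sub_log_le (simplex_apply_pos hNz.1 h₂) (simplex_apply_pos hNz.1 i₂)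
  have b₃ := log_sub_log_le (simplex_apply_pos hQz.1 h₁) (simplex_apply_pos hQz.1 i₁)
  have b₄ := log_sub_log_le (simplex_apply_pos hQz.1 i₂) (simplex_apply_pos hQz.1 h₂)
  simp only [Pi.div_apply, slope_def_module, map_smul, map_sub, smul_eq_mul]
  calc _ ≤ (z - t)⁻¹ * ((N z (γ₁ z) - N z (γ₁ t)) / N z (γ₁ t)
        + (N z (γ₂ t) - N z (γ₂ z)) / N z (γ₂ z)
        + ((Q z (γ₁ t) - Q z (γ₁ z)) / Q z (γ₁ z)
        + (Q z (γ₂ z) - Q z (γ₂ t)) / Q z (γ₂ t))) := by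
        gcongr
        linarith
    _ = _ := by ring

/-! ### The local rate bounds the contraction rate -/

theorem eq_zero_of_zero_mem_interior {C : ProperCone ℝ E} (hpointed : ∀ x ∈ C, -x ∈ C → x = 0)
    (h0 : (0 : E) ∈ interior (C : Set E)) (v : E) : v = 0 := by
  obtain ⟨s, hs, h⟩ := exists_add_smul_mem h0 v
  obtain ⟨s', hs', h'⟩ := exists_add_smul_mem h0 (-v)
  have h1 := C.smul_mem h (inv_nonneg.2 hs.le)
  have h2 := C.smul_mem h' (inv_nonneg.2 hs'.le)
  rw [zero_add, inv_smul_smul₀ hs.ne'] at h1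
  rw [zero_add, inv_smul_smul₀ hs'.ne'] at h2
  exact hpointed v h1 h2

theorem isContractionRate_of_localRate_le [FiniteDimensional ℝ E] {C : ProperCone ℝ E}
    (hpointed : ∀ x ∈ C, -x ∈ C → x = 0)
    {φ : E → E} (hφ : ContDiffOn ℝ 1 φ (interior (C : Set E)))
    (hhom : ∀ r : ℝ, 0 < r → ∀ x ∈ interior (C : Set E), φ (r • x) = r • φ x)
    {U : Set E} (hUC : U ⊆ interior (C : Set E)) (hUconv : Convex ℝ U) {a : ℝ}
    (ha : ∀ x ∈ U, localRate C φ x ≤ a) : IsContractionRate C φ U a := by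
  rintro x₁ hx₁ x₂ hx₂ t - - ⟨ht, γ₁, h10, rfl, hd1, hU1⟩ ⟨-, γ₂, h20, rfl, hd2, hU2⟩
  have he := hUC hx₁
  rcases eq_or_ne x₁ 0 with h0 | h0
  · -- An interior point is zero only if the whole space is.
    have hz := eq_zero_of_zero_mem_interior hpointed (h0 ▸ he)
    rw [hz x₁, hz x₂, hz (γ₁ t), hz (γ₂ t)]
    simp [hilbertDist, bigM]
  have hne := simplex_nonempty hpointed he h0
  have hcont : ∀ {γ : ℝ → E}, (∀ s ∈ Icc 0 t, γ s ∈ interior (C : Set E) ∧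
      HasDerivWithinAt γ (φ (γ s)) (Icc 0 t) s) → ContinuousOn γ (Icc 0 t) :=
    fun h s hs => (h s hs).2.continuousWithinAt
  have key := le_gronwallBound_of_liminf_deriv_right_le
    (f := fun s => hilbertDist C (γ₁ s) (γ₂ s)) (f' := fun s => a * hilbertDist C (γ₁ s) (γ₂ s))
    (δ := hilbertDist C x₁ x₂) (K := a) (ε := 0) (a := 0) (b := t)
    (fun s hs => tendsto_hilbertDist he hne (hcont hd1 s hs) (hcont hd2 s hs) (hd1 s hs).1
      (hd2 s hs).1)
    (fun s hs r hr => by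
      have hs' := Ico_subset_Icc_self hs
      have hmem := Icc_mem_nhdsGT_of_mem hs
      refine frequently_slope_hilbertDist_lt he hne ((hd1 s hs').2.mono_of_mem_nhdsWithin hmem)
        ((hd2 s hs').2.mono_of_mem_nhdsWithin hmem) (hd1 s hs').1 (hd2 s hs').1
        fun ν π hν hπ => lt_of_le_of_lt ?_ hr
      rw [hilbertDist_eq he (hd1 s hs').1 (hd2 s hs').1 hν hπ]
      exact logRatio_velocity_le hpointed hφ hhom hUC hUconv ha he (hU1 s hs) (hU2 s hs) hν hπ)
    (by rw [h10, h20]) (fun s _ => by simp) t (right_mem_Icc.2 ht)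
  rw [gronwallBound_ε0, sub_zero, mul_comm] at key
  exact key

/-! ### The contraction rate bounds the local rate -/

theorem exists_flowsTo [FiniteDimensional ℝ E] {C : ProperCone ℝ E} {φ : E → E}
    (hφ : ContDiffOn ℝ 1 φ (interior (C : Set E))) {U : Set E}
    (hUC : U ⊆ interior (C : Set E)) (hUopen : IsOpen U) {x : E} (hx : x ∈ U) :
    ∃ γ : ℝ → E, γ 0 = x ∧ HasDerivAt γ (φ x) 0 ∧
      ∀ᶠ h in 𝓝[>] 0, FlowsTo C φ U h x (γ h) := by
  have : CompleteSpace E := FiniteDimensional.complete ℝ E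
  obtain ⟨γ, hγ0, ε, hε, hγ⟩ :=
    (hφ.contDiffAt (isOpen_interior.mem_nhds (hUC hx))
      ).exists_forall_mem_closedBall_exists_eq_forall_mem_Ioo_hasDerivAt₀ 0
  have hd : HasDerivAt γ (φ x) 0 := by
    simpa [hγ0] using hγ 0 ⟨by linarith, by linarith⟩
  refine ⟨γ, hγ0, hd, ?_⟩
  have hU : ∀ᶠ s in 𝓝 (0 : ℝ), γ s ∈ U :=
    hd.continuousAt.eventually (hUopen.mem_nhds (by rwa [hγ0]))
  obtain ⟨δ, hδ, hδU⟩ := Metric.eventually_nhds_iff.1 hU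
  filter_upwards [Ioo_mem_nhdsGT (lt_min hε hδ)] with h hh
  obtain ⟨hhε, hhδ⟩ := lt_min_iff.1 hh.2
  have hmem : ∀ s ∈ Icc 0 h, γ s ∈ U := fun s hs => hδU (by
    rw [Real.dist_eq, sub_zero, abs_of_nonneg hs.1]; linarith [hs.2])
  refine ⟨hh.1.le, γ, hγ0, rfl, fun s hs => ⟨hUC (hmem s hs), ?_⟩,
    fun s hs => hmem s (Ico_subset_Icc_self hs)⟩
  exact (hγ s ⟨by linarith [hs.1], by linarith [hs.2]⟩).hasDerivWithinAt

theorem nonneg_of_hasDerivAt_of_eventually_nonneg {G : ℝ → ℝ} {d t : ℝ} (h : HasDerivAt G d t)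
    (h0 : G t = 0) (hG : ∀ᶠ s in 𝓝[>] t, 0 ≤ G s) : 0 ≤ d := by
  refine ge_of_tendsto ((hasDerivWithinAt_iff_tendsto_slope' (s := Ioi t) (lt_irrefl t)).1
    (h.hasDerivWithinAt (s := Ioi t))) ?_
  filter_upwards [hG, self_mem_nhdsWithin] with s hs hts
  rw [slope_def_field, h0, sub_zero]
  exact div_nonneg hs (sub_pos.2 hts).le

/-- The contraction inequality is differentiated twice: at time `0`, for the orbits of `x` and
`x + ε z`, and then at `ε = 0`. The functionals `ν` and `π` realize the distance
`d_H(x + ε z, x) = log (1 + ε)`. -/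
theorem localRate_le_of_isContractionRate [FiniteDimensional ℝ E] {C : ProperCone ℝ E}
    {φ : E → E} (hφ : ContDiffOn ℝ 1 φ (interior (C : Set E)))
    (hhom : ∀ r : ℝ, 0 < r → ∀ x ∈ interior (C : Set E), φ (r • x) = r • φ x)
    {U : Set E} (hUC : U ⊆ interior (C : Set E)) (hUopen : IsOpen U) {a : ℝ}
    (ha : IsContractionRate C φ U a) {x : E} (hx : x ∈ U) : localRate C φ x ≤ a := by
  rw [localRate_le_iff]
  intro z hz ν hν π hπ hsum
  have hxC := hUC hx
  have hzC : z ∈ C := by simpa using hz.1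
  have hπz : π z = 0 := by linarith [hπ.1 z hzC, hν.1 _ hz.2]
  have hνz : ν z = 1 := by
    have := hsum
    rw [map_sub, hν.2] at this
    linarith
  have hνε : ∀ ε : ℝ, ν (x + ε • z) = 1 + ε := by simp [hν.2, hνz]
  have hπε : ∀ ε : ℝ, π (x + ε • z) = 1 := by simp [hπ.2, hπz]
  have hcont : Tendsto (fun ε : ℝ => x + ε • z) (𝓝 0) (𝓝 x) := by
    have : Continuous fun ε : ℝ => x + ε • z := by fun_prop
    simpa using this.tendsto 0
  have dz : HasDerivAt (fun ε : ℝ => x + ε • z) z 0 := by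
    simpa using ((hasDerivAt_id (0 : ℝ)).smul_const z).const_add x
  have step : ∀ᶠ ε : ℝ in 𝓝[>] 0, 0 ≤ a * Real.log (1 + ε) -
      ((ν (φ (x + ε • z)) / (1 + ε) - ν (φ x)) - (π (φ (x + ε • z)) - π (φ x))) := by
    filter_upwards [(hcont.mono_left nhdsWithin_le_nhds).eventually (hUopen.mem_nhds hx),
      self_mem_nhdsWithin] with ε hεU hε
    replace hε : 0 < ε := hε
    have hdist : hilbertDist C (x + ε • z) x = Real.log (1 + ε) := by
      rw [hilbertDist_eq hxC (hUC hεU) hxC (ν := ν) (π := π) ⟨hν, fun μ hμ => ?_⟩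
        ⟨hπ, fun μ hμ => ?_⟩, hνε, hπε, hν.2, hπ.2]
      · simp
      · have := hμ.1 _ hz.2
        rw [map_sub, hμ.2] at this
        rw [hνε, hν.2, hμ.2, map_add, map_smul, hμ.2, smul_eq_mul]
        nlinarith
      · have := mul_nonneg hε.le (hμ.1 z hzC)
        rw [hπε, hπ.2, hμ.2, map_add, map_smul, hμ.2, smul_eq_mul]
        linarith
    obtain ⟨γ₁, h10, hd1, hf1⟩ := exists_flowsTo hφ hUC hUopen hεU
    obtain ⟨γ₀, h00, hd0, hf0⟩ := exists_flowsTo hφ hUC hUopen hx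
    have dlog : ∀ {μ : StrongDual ℝ E} {γ : ℝ → E} {y : E}, γ 0 = y → HasDerivAt γ (φ y) 0 →
        0 < μ y → HasDerivAt (fun s => Real.log (μ (γ s))) (μ (φ y) / μ y) 0 := by
      rintro μ γ _ rfl hd hpos
      exact (μ.hasFDerivAt.comp_hasDerivAt (0 : ℝ) hd).log hpos.ne'
    have dexp : HasDerivAt (fun s => Real.exp (a * s) * Real.log (1 + ε))
        (a * Real.log (1 + ε)) 0 := by
      simpa using (((hasDerivAt_id (0 : ℝ)).const_mul a).exp).mul_const (Real.log (1 + ε))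
    have hx1 : 0 < π x := by rw [hπ.2]; norm_num
    have hx2 : 0 < ν x := by rw [hν.2]; norm_num
    have hx3 : 0 < π (x + ε • z) := by rw [hπε]; norm_num
    have hx4 : 0 < ν (x + ε • z) := by rw [hνε]; linarith
    have d := dexp.sub (((dlog h10 hd1 hx4).sub (dlog h00 hd0 hx2)).sub
      ((dlog h10 hd1 hx3).sub (dlog h00 hd0 hx1)))
    have res := nonneg_of_hasDerivAt_of_eventually_nonneg d
      (by simp [h10, h00, hνε, hπε, hν.2, hπ.2, - map_add]) (by
        filter_upwards [hf1, hf0] with s hs1 hs0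
        have h := ha _ hεU _ hx s _ _ hs1 hs0
        rw [hdist] at h
        obtain ⟨hs, γ, -, hγs, hγ, -⟩ := hs1
        obtain ⟨-, γ', -, hγs', hγ', -⟩ := hs0
        have i1 := (hγ s (right_mem_Icc.2 hs)).1
        have i0 := (hγ' s (right_mem_Icc.2 hs)).1
        rw [hγs] at i1
        rw [hγs'] at i0
        have := le_hilbertDist hxC i1 i0 hν hπ
        simp only [Pi.sub_apply]
        linarith)
    simpa only [hνε, hπε, hν.2, hπ.2, div_one] using res
  have dφ : HasDerivAt (fun ε : ℝ => φ (x + ε • z)) (fderiv ℝ φ x z) 0 :=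
    HasFDerivAt.comp_hasDerivAt (f := fun ε : ℝ => x + ε • z) 0
      (by simpa using hasFDerivAt_of_contDiffOn_interior hφ hxC) dz
  have d1 : HasDerivAt (fun ε : ℝ => 1 + ε) 1 0 := (hasDerivAt_id (0 : ℝ)).const_add 1
  have d := ((d1.log (by norm_num)).const_mul a).sub
    ((((ν.hasFDerivAt.comp_hasDerivAt (0 : ℝ) dφ).div d1 (by norm_num)).sub_const (ν (φ x))).sub
      ((π.hasFDerivAt.comp_hasDerivAt (0 : ℝ) dφ).sub_const (π (φ x))))
  have res := nonneg_of_hasDerivAt_of_eventually_nonneg d (by simp) step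
  have euler := fderiv_apply_self hφ hhom hxC
  simp only [Function.comp_apply, zero_smul, add_zero, div_one, mul_one, one_pow] at res
  simp only [map_sub, euler]
  linarith

theorem contractionRate_eq_iSup_localRate [FiniteDimensional ℝ E] {C : ProperCone ℝ E}
    (hpointed : ∀ x ∈ C, -x ∈ C → x = 0)
    {φ : E → E} (hφ : ContDiffOn ℝ 1 φ (interior (C : Set E)))
    (hhom : ∀ r : ℝ, 0 < r → ∀ x ∈ interior (C : Set E), φ (r • x) = r • φ x)
    {U : Set E} (hUC : U ⊆ interior (C : Set E)) (hUconv : Convex ℝ U) (hUopen : IsOpen U) :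
    contractionRate C φ U = ⨆ x ∈ U, localRate C φ x := by
  refine le_antisymm ?_ ?_
  · refine EReal.le_of_forall_lt_iff_le.1 fun a ha => iInf₂_le a ?_
    exact isContractionRate_of_localRate_le hpointed hφ hhom hUC hUconv fun x hx =>
      (le_iSup₂ (f := fun x (_ : x ∈ U) => localRate C φ x) x hx).trans ha.le
  · exact le_iInf₂ fun a ha => iSup₂_le fun x hx =>
      localRate_le_of_isContractionRate hφ hhom hUC hUopen ha hx

end HilbertFlow

theorem mainTheorem4 {E : Type*} [NormedAddCommGroup E] [NormedSpace ℝ E] [FiniteDimensional ℝ E]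
    (C : ProperCone ℝ E) (hpointed : ∀ x ∈ C, -x ∈ C → x = 0)
    (hint : (interior (C : Set E)).Nonempty)
    (φ : E → E) (hφ : ContDiffOn ℝ 1 φ (interior (C : Set E)))
    (hhom : ∀ r : ℝ, 0 < r → ∀ x ∈ interior (C : Set E), φ (r • x) = r • φ x)
    (U : Set E) (hUC : U ⊆ interior (C : Set E)) (hUconv : Convex ℝ U) (hUopen : IsOpen U)
    (hUcone : ∀ r : ℝ, 0 < r → r • U = U) :
    HilbertFlow.contractionRate C φ U = (⨆ x ∈ U, HilbertFlow.localRate C φ x) ∧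
    (∀ x ∈ interior (C : Set E),
      HilbertFlow.localRate C φ x = HilbertFlow.localRateExtr C φ x) := by
  exact ⟨HilbertFlow.contractionRate_eq_iSup_localRate hpointed hφ hhom hUC hUconv hUopen,
    fun x hx => HilbertFlow.localRate_eq_localRateExtr hpointed φ hx⟩
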